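/- **Setting.** Fix $\alpha>0$. For a finite tree $S$ (the seed) with $k\ge 2$ vertices, the $\alpha$-PA trees $(T_n^S)_{n\ge k}$ form the Markov chain with $T_k^S=S$ in which, given $T_n^S=T$, a vertex $u$ of $T$ is chosen with probability $\frac{\deg_T(u)-1+\alpha}{(1+\alpha)n-2}$ and a new vertex is linked to $u$ by an edge; thus $S\subseteq T_n^S$. Write $\phi:\tau\hookrightarrow T$ for an embedding (injective graph homomorphism) of a finite tree $\tau$ in a tree $T$. For $d:\tau\to\mathbb{N}^*$, the embedding $\phi$ is a *perfect embedding* of $(\tau,d)$ if $\deg_T(\phi(u))=d(u)$ for all vertices $u$ of $\tau$; $D_{\tau,d}(T)$ is the number of perfect embeddings of $(\tau,d)$ in $T$. For trees $S,S'$ of the same size, $\tau$ is *$(S,S')$-blind* if $D_{\tau,d}(S)=D_{\tau,d}(S')$ for every $d:\tau\to\mathbb{N}^*$. A *minimal* tree that is not $(S,S')$-blind is a tree $\tau$ that is not $(S,S')$-blind but all of whose proper (nonempty) subtrees are. For a nonempty subtree $\sigma\subseteq\tau$, $D_{\sigma,\tau,d}(T_n^S)$ is the number of perfect embeddings $\Phi$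 of $(\tau,d)$ in $T_n^S$ with $\Phi(\tau)\cap S=\Phi(\sigma)$ (as sets of vertices). For $\ell:\tau\to\mathbb{N}$, with $[x]_0=1$ and $[x]_j=x(x-1)\cdots(x-j+1)$, set $$\mathcal F_{(\tau,\ell)}(T)=\sum_{\phi:\tau\hookrightarrow T}\ \prod_{u\in\tau}[\deg_T(\phi(u))-1]_{\ell(u)},\qquad \mathcal F_{(\tau,\ell)}(T_n^S,\{\cdot\}\subseteq S)=\sum_{\phi:\tau\hookrightarrow S}\ \prod_{u\in\tau}[\deg_{T_n^S}(\phi(u))-1]_{\ell(u)}.$$ **Statement.** Let $S,S'$ be seed trees of common size $k\ge 3$ and let $\tau$ be a finite tree. (1) For every nonempty subtree $\sigma\subseteq\tau$ that is $(S,S')$-blind, every $d:\tau\to\mathbb{N}^*$ and every $n\ge k$, $$\mathbb{E}[D_{\sigma,\tau,d}(T_n^S)]=\mathbb{E}[D_{\sigma,\tau,d}(T_n^{S'})].$$ (2) If $\tau$ is a minimal tree that is not $(S,S')$-blind, then for every $\ell:\tau\to\mathbb{N}$ and every $n\ge k$, $$\mathbb{E}[\mathcal F_{(\tau,\ell)}(T_n^S)]-\mathbb{E}[\mathcal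 F_{(\tau,\ell)}(T_n^{S'})]=\mathbb{E}[\mathcal F_{(\tau,\ell)}(T_n^S,\{\cdot\}\subseteq S)]-\mathbb{E}[\mathcal F_{(\tau,\ell)}(T_n^{S'},\{\cdot\}\subseteq S')].$$ -/

import Mathlib

noncomputable section

namespace AffinePA

open Finset

open scoped Classical in
/-- The degree of a vertex of a finite graph. -/
def deg {V : Type*} [Fintype V] (G : SimpleGraph V) (v : V) : ℕ := G.degree v

/-! ### Trees on `{0, …, n-1}` and the attachment of a new leaf -/

/-- Trees with vertex set `{0, …, n-1}`. -/
abbrev LTree (n : ℕ) : Type := {G : SimpleGraph (Fin n) // G.IsTree}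

instance (n : ℕ) : Fintype (LTree n) := Fintype.ofFinite _

/-- Add the new vertex `n` to a graph on `{0, …, n-1}` and join it to `u` by an edge. -/
def attachGraph {n : ℕ} (G : SimpleGraph (Fin n)) (u : Fin n) : SimpleGraph (Fin (n + 1)) :=
  G.map (Fin.castSucc : Fin n → Fin (n + 1)) ⊔ SimpleGraph.edge u.castSucc (Fin.last n)

theorem attachGraph_isTree {n : ℕ} {G : SimpleGraph (Fin n)} (hG : G.IsTree) (u : Fin n) :
    (attachGraph G u).IsTree := by
  classical
  have hne : u.castSucc ≠ Fin.last n := (Fin.castSucc_lt_last u).ne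
  have hiso : ∀ b, ¬ (G.map (Fin.castSucc : Fin n → Fin (n + 1))).Adj (Fin.last n) b := by
    intro b h
    obtain ⟨-, x, y, -, hx, -⟩ := h
    exact (Fin.castSucc_lt_last x).ne hx
  rw [SimpleGraph.isTree_iff_connected_and_card]
  have hr : ∀ a : Fin n, (attachGraph G u).Reachable u.castSucc a.castSucc := fun a =>
    ((hG.1.preconnected u a).map (SimpleGraph.Embedding.map Fin.castSuccEmb G).toHom).mono
      le_sup_left
  have hl : (attachGraph G u).Reachable u.castSucc (Fin.last n) := by
    apply SimpleGraph.Adj.reachable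
    exact Or.inr (by simp [SimpleGraph.edge_adj, hne])
  have hall : ∀ a, (attachGraph G u).Reachable u.castSucc a := fun a =>
    Fin.lastCases hl hr a
  refine ⟨⟨fun a b => (hall a).symm.trans (hall b)⟩, ?_⟩
  have h1 := hG.card_edgeFinset
  have hn : ¬ (G.map (Fin.castSucc : Fin n → Fin (n + 1))).Adj u.castSucc (Fin.last n) :=
    fun h => hiso _ h.symm
  have h2 := SimpleGraph.card_edgeFinset_sup_edge
    (G.map (Fin.castSucc : Fin n → Fin (n + 1))) hn hne
  have h3 : #(G.map (Fin.castSucc : Fin n → Fin (n + 1))).edgeFinset = #G.edgeFinset := by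
    convert SimpleGraph.card_edgeFinset_map (Fin.castSuccEmb : Fin n ↪ Fin (n + 1)) G using 3
    rfl
  rw [Nat.card_eq_fintype_card, ← SimpleGraph.edgeFinset_card, Nat.card_eq_fintype_card,
    Fintype.card_fin]
  rw [Fintype.card_fin] at h1
  have h4 : #(attachGraph G u).edgeFinset = #G.edgeFinset + 1 := by
    rw [← h3, ← h2]
    unfold attachGraph
    congr!
  omega

/-- The tree obtained from `T` by joining a new leaf to `u`. -/
def attach {n : ℕ} (T : LTree n) (u : Fin n) : LTree (n + 1) :=
  ⟨attachGraph T.1 u, attachGraph_isTree T.2 u⟩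

/-! ### The affine preferential attachment tree -/

/-- The probability `(deg u - 1 + α) / ((1 + α) n - 2)` that the next vertex is linked to `u`. -/
def attachProb (α : ℝ) {n : ℕ} (T : LTree n) (u : Fin n) : ℝ :=
  ((deg T.1 u : ℝ) - 1 + α) / ((1 + α) * n - 2)

theorem one_le_deg {n : ℕ} (hn : 2 ≤ n) (T : LTree n) (u : Fin n) : 1 ≤ deg T.1 u := by
  classical
  have : Nontrivial (Fin n) := Fin.nontrivial_iff_two_le.2 hn
  have := T.2.1.preconnected.degree_pos_of_nontrivial u
  unfold deg
  rw [Nat.one_le_iff_ne_zero, ← Nat.pos_iff_ne_zero]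
  convert this

theorem attachProb_nonneg {α : ℝ} (hα : 0 < α) {n : ℕ} (hn : 2 ≤ n) (T : LTree n) (u : Fin n) :
    0 ≤ attachProb α T u := by
  have h1 : (1 : ℝ) ≤ deg T.1 u := by exact_mod_cast one_le_deg hn T u
  have h2 : (2 : ℝ) ≤ n := by exact_mod_cast hn
  unfold attachProb
  apply div_nonneg <;> nlinarith

theorem sum_attachProb {α : ℝ} (hα : 0 < α) {n : ℕ} (hn : 2 ≤ n) (T : LTree n) :
    ∑ u, attachProb α T u = 1 := by
  classical
  have h2 : (2 : ℝ) ≤ n := by exact_mod_cast hn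
  have hs : ∑ u, deg T.1 u + 2 = 2 * n := by
    have h1 := T.1.sum_degrees_eq_twice_card_edges
    have h3 := T.2.card_edgeFinset
    rw [Fintype.card_fin] at h3
    have h5 : ∑ u, deg T.1 u = ∑ u, T.1.degree u := by
      refine sum_congr rfl fun u _ => ?_
      unfold deg
      congr!
    omega
  have hs' : (∑ u, (deg T.1 u : ℝ)) + 2 = 2 * n := by exact_mod_cast hs
  have hd : (1 + α) * n - 2 ≠ 0 := by nlinarith
  unfold attachProb
  rw [← sum_div, div_eq_one_iff_eq hd]
  simp only [sum_add_distrib, sum_sub_distrib, sum_const, card_univ, Fintype.card_fin,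
    nsmul_eq_mul]
  linarith

/-- The law of the vertex of `T` to which the next vertex is linked. -/
def attachPMF (α : ℝ) (hα : 0 < α) {n : ℕ} (hn : 2 ≤ n) (T : LTree n) : PMF (Fin n) :=
  PMF.ofFintype (fun u => ENNReal.ofReal (attachProb α T u)) (by
    rw [← ENNReal.ofReal_sum_of_nonneg (fun u _ => attachProb_nonneg hα hn T u),
      sum_attachProb hα hn, ENNReal.ofReal_one])

/-- The law of the `α`-PA tree `T_{k+m}^S` grown from the seed `S` of size `k`: the law at time
`k + m` of the Markov chain that starts from `S` and at each step links a new vertex to a random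
vertex drawn from `attachPMF`. The seed vertices are the first `k` vertices. -/
def paLaw (α : ℝ) (hα : 0 < α) {k : ℕ} (hk : 2 ≤ k) (S : LTree k) : (m : ℕ) → PMF (LTree (k + m))
  | 0 => PMF.pure S
  | m + 1 => (paLaw α hα hk S m).bind fun T =>
      (attachPMF α hα (hk.trans (Nat.le_add_right k m)) T).map fun u => attach T u

/-- The expectation of a real function on a finite type. -/
def expect {X : Type*} [Fintype X] (μ : PMF X) (f : X → ℝ) : ℝ := ∑ x, (μ x).toReal * f x

/-! ### Embeddings, blind trees and observables

An embedding of a tree `τ` in a tree `T` is an injective graph homomorphism, that is, a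
`SimpleGraph.Copy τ T`. -/

/-- A perfect embedding: the degree in the target of the image of `u` is `d u`. -/
def IsPerfect {V W : Type*} [Fintype W] {τ : SimpleGraph V} {T : SimpleGraph W} (d : V → ℕ+)
    (φ : τ.Copy T) : Prop :=
  ∀ u, (d u : ℕ) = deg T (φ u)

/-- `D_{τ,d}(T)`: the number of perfect embeddings of `(τ, d)` in `T`. -/
def numPerfect {V W : Type*} [Fintype W] (τ : SimpleGraph V) (d : V → ℕ+) (T : SimpleGraph W) :
    ℕ :=
  Nat.card {φ : τ.Copy T // IsPerfect d φ}

/-- `τ` is `(T₁, T₂)`-blind. -/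
def IsBlind {V W₁ W₂ : Type*} [Fintype W₁] [Fintype W₂] (τ : SimpleGraph V)
    (T₁ : SimpleGraph W₁) (T₂ : SimpleGraph W₂) : Prop :=
  ∀ d : V → ℕ+, numPerfect τ d T₁ = numPerfect τ d T₂

/-- `τ` is a minimal tree that is not `(T₁, T₂)`-blind: every proper subtree is blind. -/
def IsMinimalNonBlind {V W₁ W₂ : Type*} [Fintype W₁] [Fintype W₂] (τ : SimpleGraph V)
    (T₁ : SimpleGraph W₁) (T₂ : SimpleGraph W₂) : Prop :=
  ¬ IsBlind τ T₁ T₂ ∧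
    ∀ σ : τ.Subgraph, σ.coe.IsTree → σ ≠ ⊤ → IsBlind σ.coe T₁ T₂

/-- The vertices of the seed inside a grown tree of size `k + m`. -/
def seedVerts (k m : ℕ) : Set (Fin (k + m)) := Set.range (Fin.castAdd m : Fin k → Fin (k + m))

/-- `D_{σ,τ,d}(T)`: the number of perfect embeddings `φ` of `(τ, d)` in `T` with
`φ(τ) ∩ S = φ(σ)`. -/
def numPerfectMeeting {V : Type*} {k m : ℕ} {τ : SimpleGraph V} (σ : τ.Subgraph) (d : V → ℕ+)
    (T : LTree (k + m)) : ℕ :=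
  Nat.card {φ : τ.Copy T.1 // IsPerfect d φ ∧ Set.range φ ∩ seedVerts k m = φ '' σ.verts}

instance copyFintype {V W : Type*} [Finite V] [Finite W] (A : SimpleGraph V) (B : SimpleGraph W) :
    Fintype (A.Copy B) :=
  have : Finite (A.Copy B) := DFunLike.finite _
  Fintype.ofFinite _

/-- The observable `F_{(τ,ℓ)}(T)`: the sum over all embeddings `φ` of `τ` in `T` of the product
over `u` of the falling factorials `[deg_T (φ u) - 1]_{ℓ u}`. -/
def observable {V W : Type*} [Fintype V] [Fintype W] (τ : SimpleGraph V) (ℓ : V → ℕ)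
    (T : SimpleGraph W) : ℕ :=
  ∑ φ : τ.Copy T, ∏ u, (deg T (φ u) - 1).descFactorial (ℓ u)

/-- The contribution to `F_{(τ,ℓ)}(T)` of the embeddings of `τ` in the seed `S`; the degrees are
those in the grown tree `T`. -/
def seedObservable {V : Type*} [Fintype V] {k m : ℕ} (τ : SimpleGraph V) (ℓ : V → ℕ)
    (S : LTree k) (T : LTree (k + m)) : ℕ :=
  ∑ φ : τ.Copy S.1, ∏ u, (deg T.1 (Fin.castAdd m (φ u)) - 1).descFactorial (ℓ u)

end AffinePA

end

noncomputable section

namespace AffinePA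

open Finset

/-! ### Degrees and adjacency after an attachment -/

/-! Fix an embedding `φ` of `σ` in the seed and track only the vertices of `φ(σ)` and all added
vertices. Adjacency and degrees on this set form a Markov chain of their own: a tracked vertex is
chosen with a probability given by its degree, and the remaining mass, wherever it falls, has the
same effect on the tracked part. So the law of the tracked part depends on the seed only through its
initial state (`expect_profile_eq`). As `σ` is connected and the seed acyclic, that state amounts to
the degrees of `φ` (`profile_copy_eq`).

An embedding of `τ` that extends `φ` and meets the seed exactly in `φ(σ)` uses tracked vertices
only, so a weighted count of such embeddings is a function of the tracked part
(`sum_extensions_eq_placementSum`). Blindness of `σ` matches its embeddings in `S` and in `S'`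
degree by degree (`IsBlind.exists_equiv`); summing over matched pairs gives
`IsBlind.expect_sum_meets_eq`, of which (1) is the case of an indicator weight.

For (2), split the embeddings of `τ` by the set of vertices sent into the seed. A disconnected set
never occurs (`preconnected_induce_seed`), a connected proper one spans a blind subtree or is empty
and cancels in the difference, and the full set leaves the seed term. -/

theorem attachGraph_adj_castSucc {n : ℕ} (G : SimpleGraph (Fin n)) (u a b : Fin n) :
    (attachGraph G u).Adj a.castSucc b.castSucc ↔ G.Adj a b := by
  have ha := (Fin.castSucc_lt_last a).ne
  have hb := (Fin.castSucc_lt_last b).ne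
  simp only [attachGraph, SimpleGraph.sup_adj, SimpleGraph.edge_adj, ha, hb, and_false,
    false_and, or_false]
  exact SimpleGraph.map_adj_apply (f := Fin.castSuccEmb)

theorem attachGraph_adj_castSucc_last {n : ℕ} (G : SimpleGraph (Fin n)) (u a : Fin n) :
    (attachGraph G u).Adj a.castSucc (Fin.last n) ↔ a = u := by
  have ha := (Fin.castSucc_lt_last a).ne
  have h : ¬ (G.map (Fin.castSucc : Fin n → Fin (n + 1))).Adj a.castSucc (Fin.last n) := by
    rintro ⟨-, x, y, -, -, hy⟩
    exact (Fin.castSucc_lt_last y).ne hy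
  simp only [attachGraph, SimpleGraph.sup_adj, SimpleGraph.edge_adj, h, false_or]
  simp [ha]

theorem deg_eq_sum {V : Type*} [Fintype V] (G : SimpleGraph V) (v : V) [DecidableRel G.Adj] :
    deg G v = ∑ w, if G.Adj v w then 1 else 0 := by
  classical
  unfold deg
  rw [← Finset.card_filter, ← SimpleGraph.card_neighborFinset_eq_degree]
  congr 1
  ext w
  simp

theorem deg_attachGraph_castSucc {n : ℕ} (G : SimpleGraph (Fin n)) (u a : Fin n) :
    deg (attachGraph G u) a.castSucc = deg G a + if a = u then 1 else 0 := by
  classical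
  simp only [deg_eq_sum, Fin.sum_univ_castSucc, attachGraph_adj_castSucc,
    attachGraph_adj_castSucc_last]

theorem deg_attachGraph_last {n : ℕ} (G : SimpleGraph (Fin n)) (u : Fin n) :
    deg (attachGraph G u) (Fin.last n) = 1 := by
  classical
  simp only [deg_eq_sum, Fin.sum_univ_castSucc, SimpleGraph.adj_comm _ (Fin.last n) (Fin.castSucc _),
    attachGraph_adj_castSucc_last]
  simp

/-- Adjacency in a tree on `{0, …, n-1}`, as a relation on `ℕ`. -/
def natAdj {n : ℕ} (T : LTree n) (i j : ℕ) : Prop :=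
  ∃ a b : Fin n, a.val = i ∧ b.val = j ∧ T.1.Adj a b

/-- The degrees of a tree on `{0, …, n-1}`, extended by `0` to `ℕ`. -/
def natDeg {n : ℕ} (T : LTree n) (i : ℕ) : ℕ := if h : i < n then deg T.1 ⟨i, h⟩ else 0

theorem natAdj_val {n : ℕ} (T : LTree n) (a b : Fin n) : natAdj T a b ↔ T.1.Adj a b := by
  constructor
  · rintro ⟨a', b', ha, hb, h⟩
    rwa [← Fin.ext ha, ← Fin.ext hb]
  · exact fun h => ⟨a, b, rfl, rfl, h⟩

theorem natDeg_val {n : ℕ} (T : LTree n) (a : Fin n) : natDeg T a = deg T.1 a := by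
  simp [natDeg]

theorem natDeg_of_le {n : ℕ} (T : LTree n) {i : ℕ} (h : n ≤ i) : natDeg T i = 0 := by
  simp [natDeg, h]

/-- Degree `0` marks a vertex that has not yet arrived. Presence in the tree can thus be read off
from degrees alone, with labels that do not depend on time. -/
theorem lt_of_natDeg_ne_zero {n : ℕ} (T : LTree n) {i : ℕ} (h : natDeg T i ≠ 0) : i < n := by
  by_contra hi
  exact h (natDeg_of_le T (not_lt.1 hi))

theorem natAdj_attach {n : ℕ} (T : LTree n) (u : Fin n) (i j : ℕ) :
    natAdj (attach T u) i j ↔ natAdj T i j ∨ (i = u ∧ j = n) ∨ (i = n ∧ j = u) := by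
  constructor
  · rintro ⟨a, b, rfl, rfl, h⟩
    change (attachGraph T.1 u).Adj a b at h
    induction a using Fin.lastCases with
    | last =>
      induction b using Fin.lastCases with
      | last => exact absurd h (SimpleGraph.irrefl _)
      | cast b =>
        rw [SimpleGraph.adj_comm, attachGraph_adj_castSucc_last] at h
        subst h
        simp
    | cast a =>
      induction b using Fin.lastCases with
      | last =>
        rw [attachGraph_adj_castSucc_last] at h
        subst h
        simp
      | cast b =>
        rw [attachGraph_adj_castSucc] at h
        exact Or.inl ⟨a, b, rfl, rfl, h⟩
  · rintro (⟨a, b, rfl, rfl, h⟩ | ⟨rfl, hj⟩ | ⟨hi, rfl⟩)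
    · exact ⟨a.castSucc, b.castSucc, rfl, rfl, (attachGraph_adj_castSucc _ _ _ _).2 h⟩
    · exact ⟨u.castSucc, Fin.last n, rfl, hj.symm, (attachGraph_adj_castSucc_last _ _ _).2 rfl⟩
    · exact ⟨Fin.last n, u.castSucc, hi.symm, rfl, ((attachGraph_adj_castSucc_last _ _ _).2 rfl).symm⟩

theorem natDeg_attach {n : ℕ} (T : LTree n) (u : Fin n) (i : ℕ) :
    natDeg (attach T u) i = natDeg T i + (if i = u then 1 else 0) + (if i = n then 1 else 0) := by
  rcases lt_trichotomy i n with h | h | h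
  · have h1 : natDeg (attach T u) i = deg T.1 ⟨i, h⟩ + if (⟨i, h⟩ : Fin n) = u then 1 else 0 := by
      rw [← deg_attachGraph_castSucc]
      exact natDeg_val (attach T u) (Fin.castSucc ⟨i, h⟩)
    rw [h1, ← natDeg_val]
    simp [Fin.ext_iff, h.ne]
  · subst h
    have h1 : natDeg (attach T u) i = 1 :=
      (natDeg_val (attach T u) (Fin.last i)).trans (deg_attachGraph_last T.1 u)
    rw [h1, natDeg_of_le T le_rfl]
    simp [u.isLt.ne']
  · rw [natDeg_of_le _ (by omega : n + 1 ≤ i), natDeg_of_le _ h.le]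
    have := u.isLt
    have h2 : i ≠ u := by omega
    simp [h2, h.ne']

/-! ### Expectations along the chain -/

theorem expect_pure {X : Type*} [Fintype X] (x : X) (f : X → ℝ) : expect (PMF.pure x) f = f x := by
  classical
  unfold expect
  rw [Finset.sum_eq_single x]
  · simp
  · intro b _ hb
    simp [hb]
  · simp

theorem expect_bind {X Y : Type*} [Fintype X] [Fintype Y] (μ : PMF X) (g : X → PMF Y) (f : Y → ℝ) :
    expect (μ.bind g) f = expect μ fun x => expect (g x) f := by
  unfold expect
  have h : ∀ y, ((μ.bind g) y).toReal = ∑ x, (μ x).toReal * (g x y).toReal := by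
    intro y
    rw [PMF.bind_apply, tsum_fintype, ENNReal.toReal_sum]
    · simp
    · exact fun x _ => ENNReal.mul_ne_top (PMF.apply_ne_top _ _) (PMF.apply_ne_top _ _)
  simp only [h, sum_mul, mul_sum]
  rw [sum_comm]
  simp only [mul_assoc]

theorem expect_map {X Y : Type*} [Fintype X] [Fintype Y] (μ : PMF X) (g : X → Y) (f : Y → ℝ) :
    expect (μ.map g) f = expect μ fun x => f (g x) := by
  rw [PMF.map, expect_bind]
  simp [expect_pure]

theorem expect_sum {X ι : Type*} [Fintype X] (μ : PMF X) (s : Finset ι) (f : ι → X → ℝ) :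
    expect μ (fun x => ∑ i ∈ s, f i x) = ∑ i ∈ s, expect μ (f i) := by
  unfold expect
  simp only [mul_sum]
  exact sum_comm

theorem expect_congr {X : Type*} [Fintype X] (μ : PMF X) {f g : X → ℝ}
    (h : ∀ x ∈ μ.support, f x = g x) : expect μ f = expect μ g := by
  refine sum_congr rfl fun x _ => ?_
  by_cases hx : x ∈ μ.support
  · rw [h x hx]
  · rw [(PMF.apply_eq_zero_iff _ _).2 hx]
    simp

theorem expect_attachPMF {α : ℝ} (hα : 0 < α) {n : ℕ} (hn : 2 ≤ n) (T : LTree n)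
    (f : Fin n → ℝ) : expect (attachPMF α hα hn T) f = ∑ u, attachProb α T u * f u := by
  refine sum_congr rfl fun u _ => ?_
  rw [attachPMF, PMF.ofFintype_apply, ENNReal.toReal_ofReal (attachProb_nonneg hα hn T u)]

theorem expect_paLaw_succ {α : ℝ} (hα : 0 < α) {k : ℕ} (hk : 2 ≤ k) (S : LTree k) (m : ℕ)
    (f : LTree (k + (m + 1)) → ℝ) :
    expect (paLaw α hα hk S (m + 1)) f =
      expect (paLaw α hα hk S m) fun T => ∑ u, attachProb α T u * f (attach T u) := by
  rw [paLaw]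
  refine (expect_bind _ _ _).trans ?_
  congr 1
  funext T
  exact (expect_map _ _ _).trans (expect_attachPMF _ _ _ _)

/-- The seed is the subgraph of the grown tree induced by its vertices. -/
theorem comap_castAdd_of_mem_support {α : ℝ} (hα : 0 < α) {k : ℕ} (hk : 2 ≤ k) (S : LTree k)
    (m : ℕ) (T : LTree (k + m)) (hT : T ∈ (paLaw α hα hk S m).support) :
    T.1.comap (Fin.castAdd m) = S.1 := by
  induction m with
  | zero =>
    rw [paLaw, PMF.support_pure, Set.mem_singleton_iff] at hT
    subst hT
    rfl
  | succ m ih =>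
    rw [paLaw] at hT
    obtain ⟨T₀, hT₀, hT⟩ := (PMF.mem_support_bind_iff _ _ _).1 hT
    obtain ⟨u, -, rfl⟩ := (PMF.mem_support_map_iff _ _ _).1 hT
    rw [← ih T₀ hT₀]
    ext a b
    exact attachGraph_adj_castSucc T₀.1 u (Fin.castAdd m a) (Fin.castAdd m b)

/-! ### The tracked part of the tree -/

/-- Adjacency and degrees on a set of tracked vertices. -/
abbrev Profile (W : Type*) : Type _ := (W → W → Prop) × (W → ℕ)

/-- The position of the tracked vertices: some vertices of the seed, and the added vertices. -/
def place {A : Type*} {k : ℕ} (φ : A → Fin k) : A ⊕ ℕ → ℕ :=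
  Sum.elim (fun a => (φ a : ℕ)) (fun j => k + j)

theorem place_injective {A : Type*} {k : ℕ} {φ : A → Fin k} (hφ : Function.Injective φ) :
    Function.Injective (place φ) := by
  rintro (a | i) (b | j) h
  · simp only [place, Sum.elim_inl] at h
    rw [hφ (Fin.ext h)]
  · have := (φ a).isLt
    simp only [place, Sum.elim_inl, Sum.elim_inr] at h
    omega
  · have := (φ b).isLt
    simp only [place, Sum.elim_inl, Sum.elim_inr] at h
    omega
  · simp only [place, Sum.elim_inr] at h
    rw [Nat.add_left_cancel h]

/-- The profile of `T` on the tracked vertices. -/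
def profile {A : Type*} {k n : ℕ} (φ : A → Fin k) (T : LTree n) : Profile (A ⊕ ℕ) :=
  (fun a b => natAdj T (place φ a) (place φ b), fun a => natDeg T (place φ a))

open scoped Classical in
/-- Adding the `m`-th new vertex and linking it to the tracked vertex `o`, if any. -/
def graft {A : Type*} (m : ℕ) (o : Option (A ⊕ ℕ)) (x : Profile (A ⊕ ℕ)) : Profile (A ⊕ ℕ) :=
  (fun a b => x.1 a b ∨ (o = some a ∧ b = Sum.inr m) ∨ (a = Sum.inr m ∧ o = some b),
    fun a => x.2 a + (if o = some a then 1 else 0) + (if a = Sum.inr m then 1 else 0))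

-- The chosen vertex `u` enters only through its tracked label `o`; all untracked choices have `o =
-- none` and the same effect.
open scoped Classical in
theorem profile_attach {A : Type*} {k m : ℕ} {φ : A → Fin k} (hφ : Function.Injective φ)
    (T : LTree (k + m)) (u : Fin (k + m)) (o : Option (A ⊕ ℕ))
    (ho : ∀ a, o = some a ↔ place φ a = u) :
    profile φ (attach T u) = graft m o (profile φ T) := by
  have hm : ∀ a, place φ a = k + m ↔ a = Sum.inr m := fun a =>
    ⟨fun h => place_injective hφ (h.trans rfl), by rintro rfl; rfl⟩
  refine Prod.ext ?_ ?_
  · funext a b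
    simp only [profile, graft, natAdj_attach, ho, hm]
  · funext a
    simp only [profile, graft, natDeg_attach]
    exact congrArg₂ _ (congrArg₂ _ rfl (if_congr (ho a).symm rfl rfl)) (if_congr (hm a) rfl rfl)

/-- The tracked vertices at time `k + m`. -/
def tracked (A : Type*) [Fintype A] (m : ℕ) : Finset (A ⊕ ℕ) :=
  (univ : Finset A).disjSum (range m)

/-- The transition operator of the profile. -/
def step (α : ℝ) {A : Type*} [Fintype A] (k m : ℕ) (F : Profile (A ⊕ ℕ) → ℝ)
    (x : Profile (A ⊕ ℕ)) : ℝ :=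
  ∑ a ∈ tracked A m, ((x.2 a : ℝ) - 1 + α) / ((1 + α) * (k + m : ℕ) - 2) * F (graft m (some a) x) +
    (1 - ∑ a ∈ tracked A m, ((x.2 a : ℝ) - 1 + α) / ((1 + α) * (k + m : ℕ) - 2)) *
      F (graft m none x)

theorem place_lt {A : Type*} [Fintype A] {k m : ℕ} (φ : A → Fin k) {a : A ⊕ ℕ}
    (ha : a ∈ tracked A m) : place φ a < k + m := by
  rcases a with a | j
  · have := (φ a).isLt
    simp only [place, Sum.elim_inl]
    omega
  · have : j < m := by simpa [tracked] using ha
    simp only [place, Sum.elim_inr]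
    omega

/-- This is the lumping property that makes the tracked part Markov: the untracked choices need not
be known individually, since their total probability is the complement of the tracked one. -/
theorem sum_attachProb_mul_profile {α : ℝ} (hα : 0 < α) {A : Type*} [Fintype A] {k m : ℕ}
    (hk : 2 ≤ k) {φ : A → Fin k} (hφ : Function.Injective φ) (F : Profile (A ⊕ ℕ) → ℝ)
    (T : LTree (k + m)) :
    ∑ u, attachProb α T u * F (profile φ (attach T u)) = step α k m F (profile φ T) := by
  classical
  let pos : {a // a ∈ tracked A m} → Fin (k + m) := fun a => ⟨place φ a.1, place_lt φ a.2⟩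
  have hpos : Function.Injective pos := fun a b h =>
    Subtype.ext (place_injective hφ (congrArg Fin.val h))
  have hsum : ∀ g : Fin (k + m) → ℝ,
      ∑ u, g u = ∑ a, g (pos a) + ∑ u ∈ (univ.image pos)ᶜ, g u := by
    intro g
    rw [← sum_add_sum_compl (univ.image pos), sum_image (fun a _ b _ h => hpos h)]
  have hprob : ∀ a, attachProb α T (pos a) =
      (((profile φ T).2 a.1 : ℝ) - 1 + α) / ((1 + α) * (k + m : ℕ) - 2) := by
    intro a
    rw [attachProb, ← natDeg_val]
    rfl
  have h1 := sum_attachProb hα (hk.trans (Nat.le_add_right k m)) T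
  rw [hsum] at h1
  have hin : ∀ a, profile φ (attach T (pos a)) = graft m (some a.1) (profile φ T) := fun a =>
    profile_attach hφ T _ _ fun b =>
      ⟨fun h => by rw [← Option.some.inj h], fun h => by rw [place_injective hφ h]⟩
  have hout : ∀ u ∈ (univ.image pos)ᶜ,
      attachProb α T u * F (profile φ (attach T u)) =
        attachProb α T u * F (graft m none (profile φ T)) := by
    intro u hu
    rw [profile_attach hφ T u none]
    intro a
    refine ⟨fun h => by simp at h, fun h => ?_⟩
    -- A label `Sum.inr j` with `m ≤ j` sits at position `k + j`, beyond every vertex `u` of the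
    -- current tree.
    have ha : a ∈ tracked A m := by
      rcases a with a | j
      · simp [tracked]
      · have := u.isLt
        simp only [place, Sum.elim_inr] at h
        have : j < m := by omega
        simpa [tracked] using this
    exact absurd (mem_image.2 ⟨⟨a, ha⟩, mem_univ _, Fin.ext h⟩) (mem_compl.1 hu)
  rw [hsum, sum_congr rfl hout, ← sum_mul, eq_sub_iff_add_eq'.2 h1, step]
  simp only [hin, hprob]
  rw [← sum_coe_sort (tracked A m), ← sum_coe_sort (tracked A m)]

/-- The law of the tracked part of the tree depends on the seed only through the tracked part of
the seed. -/
theorem expect_profile_eq {α : ℝ} (hα : 0 < α) {A : Type*} [Fintype A] {k : ℕ} (hk : 2 ≤ k)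
    {S S' : LTree k} {φ φ' : A → Fin k} (hφ : Function.Injective φ) (hφ' : Function.Injective φ')
    (h : profile φ S = profile φ' S') (m : ℕ) (F : Profile (A ⊕ ℕ) → ℝ) :
    expect (paLaw α hα hk S m) (fun T => F (profile φ T)) =
      expect (paLaw α hα hk S' m) (fun T => F (profile φ' T)) := by
  -- Conditioning on the last attachment replaces `F` by `step α k m F`, hence the general `F`.
  induction m generalizing F with
  | zero =>
    rw [paLaw, paLaw]
    refine (expect_pure _ _).trans (Eq.trans ?_ (expect_pure _ _).symm)
    exact congrArg F h
  | succ m ih =>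
    rw [expect_paLaw_succ, expect_paLaw_succ]
    simp only [sum_attachProb_mul_profile hα hk hφ, sum_attachProb_mul_profile hα hk hφ']
    exact ih _

/-! ### Embeddings that meet the seed in a given subtree -/

/-- `ψ` places `τ` in the tracked part, with exactly `σ` in the seed. -/
def IsPlacement {V : Type*} {τ : SimpleGraph V} (σ : τ.Subgraph) (x : Profile (σ.verts ⊕ ℕ))
    (ψ : V → σ.verts ⊕ ℕ) : Prop :=
  Function.Injective ψ ∧ (∀ u v, τ.Adj u v → x.1 (ψ u) (ψ v)) ∧ (∀ u, x.2 (ψ u) ≠ 0) ∧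
    (∀ u (h : u ∈ σ.verts), ψ u = Sum.inl ⟨u, h⟩) ∧ ∀ u, u ∉ σ.verts → ∃ j, ψ u = Sum.inr j

/-- The sum over placements of a weight of the degrees. -/
def placementSum {V : Type*} {τ : SimpleGraph V} (σ : τ.Subgraph) (w : (V → ℕ) → ℝ)
    (x : Profile (σ.verts ⊕ ℕ)) : ℝ :=
  ∑ᶠ ψ : {ψ // IsPlacement σ x ψ}, w fun u => x.2 (ψ.1 u)

/-- `φ` maps exactly the vertices of `σ` into the seed. -/
def Meets {V : Type*} {k m : ℕ} {τ : SimpleGraph V} (σ : τ.Subgraph)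
    {T : LTree (k + m)} (Φ : τ.Copy T.1) : Prop :=
  Set.range Φ ∩ seedVerts k m = Φ '' σ.verts

theorem mem_seedVerts {k m : ℕ} (x : Fin (k + m)) : x ∈ seedVerts k m ↔ x.val < k := by
  constructor
  · rintro ⟨a, rfl⟩
    exact a.isLt
  · exact fun h => ⟨⟨x, h⟩, rfl⟩

theorem meets_iff {V : Type*} {k m : ℕ} {τ : SimpleGraph V} (σ : τ.Subgraph)
    {T : LTree (k + m)} (Φ : τ.Copy T.1) : Meets σ Φ ↔ ∀ u, (Φ u).val < k ↔ u ∈ σ.verts := by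
  unfold Meets
  constructor
  · intro h u
    rw [← mem_seedVerts]
    constructor
    · intro hu
      have : Φ u ∈ Φ '' σ.verts := h ▸ ⟨⟨u, rfl⟩, hu⟩
      obtain ⟨v, hv, hvu⟩ := this
      rwa [← Φ.injective hvu]
    · intro hu
      have : Φ u ∈ Set.range Φ ∩ seedVerts k m := h ▸ ⟨u, hu, rfl⟩
      exact this.2
  · intro h
    ext x
    constructor
    · rintro ⟨⟨u, rfl⟩, hu⟩
      exact ⟨u, (h u).1 ((mem_seedVerts _).1 hu), rfl⟩
    · rintro ⟨u, hu, rfl⟩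
      exact ⟨⟨u, rfl⟩, (mem_seedVerts _).2 ((h u).2 hu)⟩

open scoped Classical in
/-- The embeddings that extend a given embedding of `σ` in the seed correspond to the
placements. -/
theorem sum_extensions_eq_placementSum {V : Type*} [Fintype V] {k m : ℕ} (hk : 2 ≤ k)
    {τ : SimpleGraph V} (σ : τ.Subgraph) (w : (V → ℕ) → ℝ) (T : LTree (k + m))
    (φ : σ.verts → Fin k) (hφ : Function.Injective φ) :
    (∑ Φ : τ.Copy T.1 with Meets σ Φ ∧ ∀ u : σ.verts, Φ u = Fin.castAdd m (φ u),
      w fun u => deg T.1 (Φ u)) = placementSum σ w (profile φ T) := by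
  have hn : 2 ≤ k + m := by omega
  let P : τ.Copy T.1 → Prop := fun Φ => Meets σ Φ ∧ ∀ u : σ.verts, Φ u = Fin.castAdd m (φ u)
  -- Under `P Φ` the subtraction is not truncated: vertices outside `σ` go to positions at least
  -- `k`.
  let ψ : τ.Copy T.1 → V → σ.verts ⊕ ℕ := fun Φ u =>
    if h : u ∈ σ.verts then Sum.inl ⟨u, h⟩ else Sum.inr ((Φ u).val - k)
  have hψ : ∀ Φ, P Φ → ∀ u, place φ (ψ Φ u) = Φ u := by
    rintro Φ ⟨h1, h2⟩ u
    rw [meets_iff] at h1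
    by_cases h : u ∈ σ.verts
    · simp only [ψ, h, dif_pos, place, Sum.elim_inl, h2 ⟨u, h⟩, Fin.val_castAdd]
    · have := mt (h1 u).1 h
      simp only [ψ, h, dif_neg, not_false_eq_true, place, Sum.elim_inr]
      omega
  have hplace : ∀ Φ, P Φ → IsPlacement σ (profile φ T) (ψ Φ) := by
    intro Φ hΦ
    refine ⟨fun u v huv => ?_, fun u v huv => ?_, fun u => ?_, fun u h => ?_, fun u h => ?_⟩
    · apply Φ.injective
      exact Fin.ext (((hψ Φ hΦ u).symm.trans (congrArg _ huv)).trans (hψ Φ hΦ v))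
    · simp only [profile, hψ Φ hΦ]
      exact (natAdj_val _ _ _).2 (Φ.toHom.map_adj huv)
    · simp only [profile, hψ Φ hΦ, natDeg_val]
      have := one_le_deg hn T (Φ u)
      omega
    · simp only [ψ, h, dif_pos]
    · exact ⟨_, dif_neg h⟩
  rw [← sum_subtype_eq_sum_filter, Finset.subtype_univ, placementSum, ← finsum_eq_sum_of_fintype]
  refine finsum_eq_of_bijective
    (fun Φ : {Φ // P Φ} => (⟨ψ Φ.1, hplace Φ.1 Φ.2⟩ : {ψ // IsPlacement σ (profile φ T) ψ}))
    ⟨fun Φ Φ' h => ?_, ?_⟩ ?_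
  · apply Subtype.ext
    apply DFunLike.ext
    intro u
    apply Fin.ext
    rw [← hψ _ Φ.2, ← hψ _ Φ'.2]
    exact congrArg (place φ) (congrFun (congrArg Subtype.val h) u)
  · rintro ⟨ρ, hinj, hadj, hdeg, hin, hout⟩
    -- The nonzero degree required of a placement ensures that the position is a vertex of `T`.
    let f : V → Fin (k + m) := fun u => ⟨place φ (ρ u), lt_of_natDeg_ne_zero T (hdeg u)⟩
    let Φ : τ.Copy T.1 := ⟨⟨f, fun {u v} huv => (natAdj_val T _ _).1 (hadj u v huv)⟩,
      fun u v huv => hinj (place_injective hφ (congrArg Fin.val huv))⟩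
    have hf : ∀ u, Φ u = f u := fun u => rfl
    have hΦ : P Φ := by
      constructor
      · rw [meets_iff]
        intro u
        rw [hf]
        by_cases h : u ∈ σ.verts
        · simp [f, hin u h, h, place]
        · obtain ⟨j, hj⟩ := hout u h
          simp [f, hj, h, place]
      · rintro ⟨u, h⟩
        rw [hf]
        apply Fin.ext
        simp [f, hin u h, place]
    refine ⟨⟨Φ, hΦ⟩, Subtype.ext (funext fun u => place_injective hφ ?_)⟩
    exact hψ Φ hΦ u
  · rintro ⟨Φ, hΦ⟩
    congr 1
    funext u
    simp only [profile, hψ Φ hΦ, natDeg_val]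

-- Each `Φ` that meets the seed in `σ` restricts to exactly one embedding of `σ` in `S`, because the
-- seed is induced in `T`; the sum is fibred over these restrictions.
open scoped Classical in
theorem sum_meets_eq {V : Type*} [Fintype V] {k m : ℕ} (hk : 2 ≤ k)
    {τ : SimpleGraph V} (σ : τ.Subgraph) (w : (V → ℕ) → ℝ) (S : LTree k) (T : LTree (k + m))
    (hT : T.1.comap (Fin.castAdd m) = S.1) :
    (∑ Φ : τ.Copy T.1 with Meets σ Φ, w fun u => deg T.1 (Φ u)) =
      ∑ φ : σ.coe.Copy S.1, placementSum σ w (profile φ T) := by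
  refine Eq.trans ?_ (sum_congr rfl fun φ _ =>
    sum_extensions_eq_placementSum hk σ w T φ φ.injective)
  simp only [sum_filter]
  rw [sum_comm]
  refine sum_congr rfl fun Φ _ => ?_
  by_cases h : Meets σ Φ
  · have h' := (meets_iff _ _).1 h
    let φ : σ.coe.Copy S.1 := ⟨⟨fun u => ⟨Φ u, (h' u).2 u.2⟩, fun {u v} huv => by
      rw [← hT]
      exact Φ.toHom.map_adj (σ.adj_sub huv)⟩,
      fun u v huv => Subtype.ext (Φ.injective (by
        have := congrArg Fin.val huv
        exact Fin.ext this))⟩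
    have hφ : ∀ u : σ.verts, Φ u = Fin.castAdd m (φ u) := fun u => rfl
    rw [sum_eq_single φ]
    · simp only [h, hφ, implies_true, and_self]
    · intro φ' _ hne
      rw [if_neg]
      rintro ⟨-, h2⟩
      apply hne
      apply DFunLike.ext
      intro u
      exact Fin.castAdd_injective k m ((h2 u).symm.trans (hφ u))
    · simp
  · simp [h]

/-! ### Comparison of two seeds -/

/-- The pullback of `H` along `φ` is acyclic and contains `G`. A tree is a maximal acyclic graph, so
the pullback has no further edge. -/
theorem adj_iff_of_copy {V W : Type*} {G : SimpleGraph V} {H : SimpleGraph W}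
    (hG : G.Preconnected) (hH : H.IsAcyclic) (φ : G.Copy H) (a b : V) :
    H.Adj (φ a) (φ b) ↔ G.Adj a b := by
  refine ⟨fun h => ?_, fun h => φ.toHom.map_adj h⟩
  have hc : (H.comap φ).IsAcyclic := hH.of_comap ⟨φ, φ.injective⟩
  have hle : G ≤ H.comap φ := fun x y hxy => φ.toHom.map_adj hxy
  have : Nonempty V := ⟨a⟩
  have ht : G.IsTree := ⟨⟨hG⟩, hc.anti hle⟩
  exact (SimpleGraph.maximal_isAcyclic_iff_isTree.2 ht).2 hc hle h

theorem profile_copy_eq {A : Type*} {k : ℕ} {G : SimpleGraph A} (hG : G.Preconnected)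
    {S S' : LTree k} (φ : G.Copy S.1) (φ' : G.Copy S'.1)
    (h : ∀ a, deg S.1 (φ a) = deg S'.1 (φ' a)) : profile φ S = profile φ' S' := by
  have hlt : ∀ (T : LTree k) (x j : ℕ), ¬ natAdj T x (k + j) ∧ ¬ natAdj T (k + j) x := by
    refine fun T x j => ⟨?_, ?_⟩
    · rintro ⟨a, b, -, hb, -⟩
      have := b.isLt
      omega
    · rintro ⟨a, b, ha, -, -⟩
      have := a.isLt
      omega
  refine Prod.ext ?_ ?_
  · funext a b
    rcases a with a | i <;> rcases b with b | j <;>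
      simp only [profile, place, Sum.elim_inl, Sum.elim_inr, hlt, natAdj_val,
        adj_iff_of_copy hG S.2.2, adj_iff_of_copy hG S'.2.2]
  · funext a
    rcases a with a | i
    · simp only [profile, place, Sum.elim_inl, natDeg_val, h]
    · simp only [profile, place, Sum.elim_inr, natDeg_of_le _ (Nat.le_add_right k i)]

/-- Embeddings are grouped by their degree function, which is positive as `2 ≤ k`; blindness says
that corresponding fibres have equal size. -/
theorem IsBlind.exists_equiv {V : Type*} [Finite V] {k : ℕ} (hk : 2 ≤ k) {G : SimpleGraph V}
    {S S' : LTree k} (h : IsBlind G S.1 S'.1) :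
    ∃ e : G.Copy S.1 ≃ G.Copy S'.1, ∀ φ a, deg S.1 (φ a) = deg S'.1 (e φ a) := by
  let f : ∀ T : LTree k, G.Copy T.1 → V → ℕ+ := fun T φ a =>
    ⟨deg T.1 (φ a), one_le_deg hk T _⟩
  have hf : ∀ (T : LTree k) (φ : G.Copy T.1) d, f T φ = d ↔ IsPerfect d φ := by
    intro T φ d
    rw [funext_iff]
    exact forall_congr' fun u => ⟨fun hu => by rw [← hu]; rfl, fun hu => PNat.eq hu.symm⟩
  have hfin : ∀ T : LTree k, Finite (G.Copy T.1) := fun T => inferInstance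
  have he : ∀ d, Nonempty ({φ // f S φ = d} ≃ {φ // f S' φ = d}) := by
    intro d
    have := h d
    unfold numPerfect at this
    refine ⟨(Equiv.subtypeEquivRight fun φ => hf S φ d).trans
      ((Finite.card_eq.1 this).some.trans (Equiv.subtypeEquivRight fun φ => (hf S' φ d).symm))⟩
  refine ⟨Equiv.ofFiberEquiv fun d => (he d).some, fun φ a => ?_⟩
  have := Equiv.ofFiberEquiv_map (fun d => (he d).some) φ
  exact (congrArg PNat.val (congrFun this a)).symm

open scoped Classical in
/-- For a blind `σ`, weighted counts of the embeddings that meet the seed in `σ` have the same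
expectation from both seeds. -/
theorem IsBlind.expect_sum_meets_eq {α : ℝ} (hα : 0 < α) {k : ℕ} (hk : 2 ≤ k) {S S' : LTree k}
    {V : Type*} [Fintype V] {τ : SimpleGraph V} {σ : τ.Subgraph} (hσ : σ.coe.Preconnected)
    (h : IsBlind σ.coe S.1 S'.1) (w : (V → ℕ) → ℝ) (m : ℕ) :
    expect (paLaw α hα hk S m)
        (fun T => ∑ Φ : τ.Copy T.1 with Meets σ Φ, w fun u => deg T.1 (Φ u)) =
      expect (paLaw α hα hk S' m)
        (fun T => ∑ Φ : τ.Copy T.1 with Meets σ Φ, w fun u => deg T.1 (Φ u)) := by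
  have key : ∀ S₀ : LTree k, expect (paLaw α hα hk S₀ m)
      (fun T => ∑ Φ : τ.Copy T.1 with Meets σ Φ, w fun u => deg T.1 (Φ u)) =
      ∑ φ : σ.coe.Copy S₀.1,
        expect (paLaw α hα hk S₀ m) fun T => placementSum σ w (profile φ T) := by
    intro S₀
    rw [← expect_sum]
    exact expect_congr _ fun T hT =>
      sum_meets_eq hk σ w S₀ T (comap_castAdd_of_mem_support hα hk S₀ m T hT)
  obtain ⟨e, he⟩ := h.exists_equiv hk
  rw [key, key, ← e.sum_comp]
  refine sum_congr rfl fun φ _ => ?_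
  exact expect_profile_eq hα hk φ.injective (e φ).injective (profile_copy_eq hσ _ _ (he φ)) m _

open scoped Classical in
theorem numPerfectMeeting_eq_sum {V : Type*} [Fintype V] {k m : ℕ} {τ : SimpleGraph V}
    (σ : τ.Subgraph) (d : V → ℕ+) (T : LTree (k + m)) :
    (numPerfectMeeting σ d T : ℝ) =
      ∑ Φ : τ.Copy T.1 with Meets σ Φ,
        (fun δ : V → ℕ => if ∀ u, (d u : ℕ) = δ u then (1 : ℝ) else 0) fun u => deg T.1 (Φ u) := by
  rw [numPerfectMeeting, Nat.card_eq_fintype_card, Fintype.card_subtype]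
  simp only [sum_boole, filter_filter]
  congr 2
  exact filter_congr fun Φ _ => and_comm

/-- The seed meets a subtree of the grown tree in a subtree. -/
theorem preconnected_induce_seed {V : Type*} {k m : ℕ} {τ : SimpleGraph V} (hτ : τ.IsTree)
    {S : LTree k} {T : LTree (k + m)} (hT : T.1.comap (Fin.castAdd m) = S.1) (Φ : τ.Copy T.1) :
    (τ.induce {u | (Φ u).val < k}).Preconnected := by
  rintro ⟨u, hu⟩ ⟨v, hv⟩
  let f : S.1 →g T.1 := ⟨Fin.castAdd m, fun {a b} h => by rw [← hT] at h; exact h⟩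
  have hf : Function.Injective f := Fin.castAdd_injective k m
  obtain ⟨p, hp, -⟩ := hτ.existsUnique_path u v
  obtain ⟨q, hq, -⟩ := S.2.existsUnique_path ⟨Φ u, hu⟩ ⟨Φ v, hv⟩
  have huniq := T.2.existsUnique_path (Φ u) (Φ v)
  -- The image of the path in `τ` and the path inside the seed join the same two vertices of the
  -- tree `T`, so they coincide.
  have heq : p.map Φ.toHom = q.map f :=
    huniq.unique (hp.map Φ.injective)
      (hq.map hf)
  have hs : ∀ x ∈ p.support, x ∈ {u | (Φ u).val < k} := by
    intro x hx
    have h1 : Φ x ∈ (p.map Φ.toHom).support := by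
      rw [SimpleGraph.Walk.support_map]
      exact List.mem_map_of_mem hx
    rw [heq, SimpleGraph.Walk.support_map] at h1
    obtain ⟨y, -, hy⟩ := List.mem_map.1 h1
    change (Φ x).val < k
    rw [← hy]
    exact y.isLt
  exact ⟨p.induce _ hs⟩

-- The fibres are those of the set of vertices sent into the seed. `Meets` depends only on the
-- vertices of the subgraph, so the induced one can represent each set.
open scoped Classical in
theorem sum_copy_eq_sum_meets {V : Type*} [Fintype V] {k m : ℕ} {τ : SimpleGraph V}
    (T : LTree (k + m)) (f : τ.Copy T.1 → ℝ) :
    ∑ Φ, f Φ = ∑ s : Finset V,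
      ∑ Φ : τ.Copy T.1 with Meets ((⊤ : τ.Subgraph).induce (s : Set V)) Φ, f Φ := by
  rw [← sum_fiberwise (g := fun Φ : τ.Copy T.1 => univ.filter fun u => (Φ u).val < k)]
  refine sum_congr rfl fun s _ => sum_congr ?_ fun _ _ => rfl
  ext Φ
  simp only [mem_filter, mem_univ, true_and, meets_iff, SimpleGraph.Subgraph.induce_verts,
    mem_coe, Finset.ext_iff]

open scoped Classical in
theorem sum_meets_univ {V : Type*} [Fintype V] {k m : ℕ} {τ : SimpleGraph V}
    {S : LTree k} {T : LTree (k + m)} (hT : T.1.comap (Fin.castAdd m) = S.1)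
    (w : (V → ℕ) → ℝ) :
    (∑ Φ : τ.Copy T.1 with Meets ((⊤ : τ.Subgraph).induce ((univ : Finset V) : Set V)) Φ,
      w fun u => deg T.1 (Φ u)) =
    ∑ φ : τ.Copy S.1, w fun u => deg T.1 (Fin.castAdd m (φ u)) := by
  have hadj : ∀ a b, S.1.Adj a b ↔ T.1.Adj (Fin.castAdd m a) (Fin.castAdd m b) := by
    intro a b
    rw [← hT]
    rfl
  symm
  refine sum_bij (fun φ _ => (⟨⟨fun u => Fin.castAdd m (φ u),
      fun {u v} h => (hadj _ _).1 (φ.toHom.map_adj h)⟩,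
      fun u v h => φ.injective (Fin.castAdd_injective k m h)⟩ : τ.Copy T.1)) ?_ ?_ ?_ ?_
  · intro φ _
    simp only [mem_filter, mem_univ, true_and, meets_iff, SimpleGraph.Subgraph.induce_verts,
      mem_coe, iff_true]
    exact fun u => (φ u).isLt
  · intro φ _ φ' _ h
    apply DFunLike.ext
    intro u
    exact Fin.castAdd_injective k m (DFunLike.congr_fun h u)
  · intro Φ hΦ
    simp only [mem_filter, mem_univ, true_and, meets_iff, SimpleGraph.Subgraph.induce_verts,
      mem_coe, iff_true] at hΦ
    exact ⟨⟨⟨fun u => ⟨Φ u, hΦ u⟩, fun {u v} h => (hadj _ _).2 (Φ.toHom.map_adj h)⟩,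
      fun u v h => Φ.injective (by
        have := congrArg Fin.val h
        exact Fin.ext this)⟩, mem_univ _, rfl⟩
  · intro φ _
    rfl

/-- Embeddings of `τ` that avoid the seed correspond to the empty subgraph. It is not a tree, so
minimality does not cover it, but it is blind because it has a single embedding. -/
theorem numPerfect_of_isEmpty {V W : Type*} [Fintype W] [IsEmpty V] (τ : SimpleGraph V)
    (d : V → ℕ+) (T : SimpleGraph W) : numPerfect τ d T = 1 := by
  rw [numPerfect, Nat.card_eq_one_iff_unique]
  exact ⟨⟨fun φ φ' => Subtype.ext (DFunLike.ext _ _ fun u => isEmptyElim u)⟩,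
    ⟨⟨⟨⟨isEmptyElim, fun {u} => isEmptyElim u⟩, fun u => isEmptyElim u⟩,
      fun u => isEmptyElim u⟩⟩⟩

/-- For a minimal non-blind tree, only the embeddings in the seed contribute to the difference of
the expectations of the weighted counts from the two seeds. -/
theorem IsMinimalNonBlind.expect_sub_eq {α : ℝ} (hα : 0 < α) {k : ℕ} (hk : 2 ≤ k)
    {S S' : LTree k} {V : Type*} [Fintype V] {τ : SimpleGraph V} (hτ : τ.IsTree)
    (h : IsMinimalNonBlind τ S.1 S'.1) (w : (V → ℕ) → ℝ) (m : ℕ) :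
    expect (paLaw α hα hk S m) (fun T => ∑ Φ : τ.Copy T.1, w fun u => deg T.1 (Φ u)) -
      expect (paLaw α hα hk S' m) (fun T => ∑ Φ : τ.Copy T.1, w fun u => deg T.1 (Φ u)) =
    expect (paLaw α hα hk S m)
        (fun T => ∑ φ : τ.Copy S.1, w fun u => deg T.1 (Fin.castAdd m (φ u))) -
      expect (paLaw α hα hk S' m)
        (fun T => ∑ φ : τ.Copy S'.1, w fun u => deg T.1 (Fin.castAdd m (φ u))) := by
  classical
  have hproper : ∀ s ∈ univ.erase (univ : Finset V),
      expect (paLaw α hα hk S m) (fun T =>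
        ∑ Φ : τ.Copy T.1 with Meets ((⊤ : τ.Subgraph).induce (s : Set V)) Φ,
          w fun u => deg T.1 (Φ u)) =
      expect (paLaw α hα hk S' m) (fun T =>
        ∑ Φ : τ.Copy T.1 with Meets ((⊤ : τ.Subgraph).induce (s : Set V)) Φ,
          w fun u => deg T.1 (Φ u)) := by
    intro s hs
    set σ := (⊤ : τ.Subgraph).induce (s : Set V) with hσ
    by_cases hc : σ.coe.Preconnected
    · refine IsBlind.expect_sum_meets_eq hα hk hc ?_ w m
      rcases isEmpty_or_nonempty σ.verts with he | hne
      · exact fun d => by rw [numPerfect_of_isEmpty, numPerfect_of_isEmpty]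
      -- A nonempty connected induced subgraph of `τ` is a subtree, and it is proper since `s` is
      -- not all of `V`.
      · refine h.2 σ ⟨⟨hc⟩, hτ.2.subgraph σ⟩ fun htop => (mem_erase.1 hs).1 ?_
        have hv : (s : Set V) = Set.univ := congrArg SimpleGraph.Subgraph.verts htop
        exact_mod_cast hv
    · have hzero : ∀ S₀ : LTree k, expect (paLaw α hα hk S₀ m) (fun T =>
          ∑ Φ : τ.Copy T.1 with Meets σ Φ, w fun u => deg T.1 (Φ u)) = 0 := by
        intro S₀
        refine (expect_congr _ (g := fun _ => 0) fun T hT => ?_).trans (by simp [expect])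
        rw [filter_eq_empty_iff.2, sum_empty]
        intro Φ _ hΦ
        apply hc
        have hset : {u | (Φ u).val < k} = (s : Set V) := by
          ext u
          exact (meets_iff σ Φ).1 hΦ u
        have := preconnected_induce_seed hτ (comap_castAdd_of_mem_support hα hk S₀ m T hT) Φ
        rw [hset, SimpleGraph.induce_eq_coe_induce_top] at this
        exact this
      rw [hzero, hzero]
  have key : ∀ S₀ : LTree k,
      expect (paLaw α hα hk S₀ m) (fun T => ∑ Φ : τ.Copy T.1, w fun u => deg T.1 (Φ u)) =
      expect (paLaw α hα hk S₀ m)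
          (fun T => ∑ φ : τ.Copy S₀.1, w fun u => deg T.1 (Fin.castAdd m (φ u))) +
        ∑ s ∈ univ.erase (univ : Finset V), expect (paLaw α hα hk S₀ m) (fun T =>
          ∑ Φ : τ.Copy T.1 with Meets ((⊤ : τ.Subgraph).induce (s : Set V)) Φ,
            w fun u => deg T.1 (Φ u)) := by
    intro S₀
    simp only [sum_copy_eq_sum_meets]
    -- The set `s = univ` is the case of embeddings lying wholly in the seed.
    rw [expect_sum, ← add_sum_erase univ _ (mem_univ (univ : Finset V))]
    congr 1
    exact expect_congr _ fun T hT =>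
      sum_meets_univ (comap_castAdd_of_mem_support hα hk S₀ m T hT) w
  rw [key S, key S', sum_congr rfl hproper]
  ring

end AffinePA

end

open AffinePA in
theorem mainTheorem7 (α : ℝ) (hα : 0 < α) (k : ℕ) (hk : 3 ≤ k) (S S' : LTree k)
    {V : Type*} [Fintype V] (τ : SimpleGraph V) (hτ : τ.IsTree) :
    (∀ σ : τ.Subgraph, σ.coe.IsTree → IsBlind σ.coe S.1 S'.1 →
      ∀ (d : V → ℕ+) (m : ℕ),
        expect (paLaw α hα (Nat.le_of_succ_le hk) S m) (fun T => (numPerfectMeeting σ d T : ℝ)) =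
        expect (paLaw α hα (Nat.le_of_succ_le hk) S' m)
          (fun T => (numPerfectMeeting σ d T : ℝ))) ∧
    (IsMinimalNonBlind τ S.1 S'.1 →
      ∀ (ℓ : V → ℕ) (m : ℕ),
        expect (paLaw α hα (Nat.le_of_succ_le hk) S m) (fun T => (observable τ ℓ T.1 : ℝ)) -
          expect (paLaw α hα (Nat.le_of_succ_le hk) S' m) (fun T => (observable τ ℓ T.1 : ℝ)) =
        expect (paLaw α hα (Nat.le_of_succ_le hk) S m)
            (fun T => (seedObservable τ ℓ S T : ℝ)) -
          expect (paLaw α hα (Nat.le_of_succ_le hk) S' m)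
            (fun T => (seedObservable τ ℓ S' T : ℝ))) := by
  refine ⟨fun σ hσ hb d m => ?_, fun h ℓ m => ?_⟩
  · have key := hb.expect_sum_meets_eq hα (Nat.le_of_succ_le hk) hσ.1.preconnected
      (fun δ : V → ℕ => if ∀ u, (d u : ℕ) = δ u then (1 : ℝ) else 0) m
    simp only [numPerfectMeeting_eq_sum]
    exact key
  · have key := h.expect_sub_eq hα (Nat.le_of_succ_le hk) hτ
      (fun δ => ((∏ u, (δ u - 1).descFactorial (ℓ u) : ℕ) : ℝ)) m
    simp only [observable, seedObservable, Nat.cast_sum]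
    exact key
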